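/- Consider a two-armed Gaussian bandit with budget $n\ge 1$. The unknown mean rewards $\mu=(\mu_1,\mu_2)$ are drawn from a prior under which $\mu_1,\mu_2$ are independent with $\mu_i\sim\mathcal N(\nu_i,\sigma_0^2)$. Given $\mu$, each pull of arm $i$ yields an independent reward with law $\mathcal N(\mu_i,\sigma^2)$. A policy chooses, possibly adaptively and at random, which arm to pull in each of the $n$ rounds on the basis of the arms pulled and rewards observed so far, and afterwards recommends an arm $J\in\{1,2\}$; it may also use the prior, which is known to it. Let $i_*(\mu)=\arg\max_{i\in\{1,2\}}\mu_i$, let $\mathbb P(J\ne i_*(\mu)\mid\mu)$ be the probability of misidentification given $\mu$, and let $\mathbb E_{\mu}[\mathbb P(J\neq i_*(\mu)\mid\mu)]$ be its expectation over the prior. Let $n\ge 1$, $\sigma>0$ and $\sigma_0>0$. For every policy there exist prior means $\nu_1,\nu_2\in\mathbb R$ such that the policy, run in the bandit with prior $\mu_i\sim\mathcal N(\nu_i,\sigma_0^2)$, satisfies $$\mathbb E_{\mu}\big[\mathbb P(J\ne i_*(\mu)\mid\mu)\big]\;\ge\;\frac1{2e}\sqrt{\frac{\sigma^2}{2n\,(8\log(2n)+1)\,\sigma_0^2+\sigma^2}}\;\exp\!\Big(-\frac{(\nu_1-\nu_2)^2}{4\sigma_0^2}\Big).$$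 -/

import Mathlib

open MeasureTheory ProbabilityTheory

noncomputable section

/-- A history of `t` rounds of a `K`-armed bandit: for each round the arm that was pulled and
the reward that was observed. -/
abbrev History (K t : ℕ) : Type := Fin t → Fin K × ℝ

/-- A (possibly adaptive and randomized) policy with budget `n` for a `K`-armed bandit. In round
`t < n` it draws the next arm from a distribution that depends measurably on the history of the
first `t` rounds; after `n` rounds it draws its recommendation from a distribution that depends
measurably on the whole history. -/
structure Policy (K n : ℕ) where
  /-- the conditional law of the arm pulled in the next round, given the past `t` rounds -/
  arm : ∀ t : Fin n, Kernel (History K t) (Fin K)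
  /-- the conditional law of the recommended arm, given all `n` rounds -/
  recommend : Kernel (History K n) (Fin K)
  isMarkov_arm : ∀ t, IsMarkovKernel (arm t)
  isMarkov_recommend : IsMarkovKernel recommend

attribute [instance] Policy.isMarkov_arm Policy.isMarkov_recommend

/-- The reward distributions `N(μ i, σ²)`, as a Markov kernel from arms to rewards. -/
def rewardKernel {K : ℕ} (σ : ℝ) (μ : Fin K → ℝ) : Kernel (Fin K) ℝ where
  toFun i := gaussianReal (μ i) (σ ^ 2).toNNReal
  measurable' := measurable_of_countable _

/-- The law of the history of the first `t` rounds when the policy plays the bandit with mean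
rewards `μ` and reward variance `σ²`: each round appends an arm drawn by the policy and an
independent fresh reward from the distribution of that arm. -/
def Policy.historyLaw {K n : ℕ} (p : Policy K n) (σ : ℝ) (μ : Fin K → ℝ) :
    ∀ t : ℕ, t ≤ n → Measure (History K t)
  | 0, _ => Measure.dirac Fin.elim0
  | t + 1, h =>
    ((p.historyLaw σ μ t (Nat.le_of_succ_le h)) ⊗ₘ
      ((p.arm ⟨t, h⟩) ⊗ₖ (Kernel.prodMkLeft (History K t) (rewardKernel σ μ)))).map
        (fun x => Fin.snoc (α := fun _ => Fin K × ℝ) x.1 x.2)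

/-- The law, given the mean rewards `μ`, of the arm `J` recommended after `n` rounds. -/
def Policy.recommendationLaw {K n : ℕ} (p : Policy K n) (σ : ℝ) (μ : Fin K → ℝ) :
    Measure (Fin K) :=
  (p.historyLaw σ μ n le_rfl).bind p.recommend

/-- The probability of misidentification, given the mean rewards `μ`: the probability that the
recommended arm does not maximize the mean reward. -/
def Policy.misidentificationProb {K n : ℕ} (p : Policy K n) (σ : ℝ) (μ : Fin K → ℝ) : ℝ :=
  (p.recommendationLaw σ μ).real {j | ¬ ∀ i, μ i ≤ μ j}

/-- The prior of the mean rewards: independent, with `μ i` distributed as `N(ν i, σ₀²)`. -/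
def gaussianPrior {K : ℕ} (ν : Fin K → ℝ) (σ₀ : ℝ) : Measure (Fin K → ℝ) :=
  Measure.pi (fun i => gaussianReal (ν i) (σ₀ ^ 2).toNNReal)

/-- The expected probability of misidentification, over mean rewards drawn from the prior. -/
def Policy.expectedMisidentificationProb {K n : ℕ} (p : Policy K n) (σ : ℝ)
    (ν : Fin K → ℝ) (σ₀ : ℝ) : ℝ :=
  ∫ μ, p.misidentificationProb σ μ ∂(gaussianPrior ν σ₀)

end

/-! Equal prior means suffice: the exponential factor becomes 1 and the prior is symmetric under
swapping the arms. Pair each `μ` with its swap and use both arms at the midpoint as reference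
instance. The two likelihood ratios `x`, `y` have constant product `c = exp(-n(μ 0 - μ 1)²/(4σ²))`,
however the pulls are allocated (`likelihoodRatio_mul_swap`), so adaptivity does not matter. With
mean-one `x` and `y`, a pointwise inequality (`mul_le_convex_combination_add`) bounds the two errors
together below by `c/2` (`Policy.le_recommendationLaw_add_swap`).

By symmetry the prior average of the two errors is twice the expected error. As `μ 0 - μ 1` has law
`N(0, 2σ₀²)`, the mean of `c` is an explicit Gaussian integral, giving the bound `(1/4)√(σ²/(nσ₀² +
σ²))`, which is stronger than the claim. -/

/-! ### Change of measure for bandit histories -/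

/-- A change of mean in a Gaussian integral. -/
lemma lintegral_gaussianReal_change_mean (a b : ℝ) {σ : ℝ} (hσ : 0 < σ) {f : ℝ → ENNReal}
    (hf : Measurable f) :
    ∫⁻ x, f x ∂(gaussianReal a (σ ^ 2).toNNReal) =
      ∫⁻ x, f x * ENNReal.ofReal (Real.exp (((x - b) ^ 2 - (x - a) ^ 2) / (2 * σ ^ 2)))
        ∂(gaussianReal b (σ ^ 2).toNNReal) := by
  have hv : (σ ^ 2).toNNReal ≠ 0 := by
    simpa using hσ.ne'
  rw [gaussianReal_of_var_ne_zero _ hv, gaussianReal_of_var_ne_zero _ hv,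
    lintegral_withDensity_eq_lintegral_mul _ (measurable_gaussianPDF _ _) hf,
    lintegral_withDensity_eq_lintegral_mul _ (measurable_gaussianPDF _ _) (by fun_prop)]
  refine lintegral_congr fun x => ?_
  simp only [Pi.mul_apply, gaussianPDF_def]
  rw [mul_comm (f x), ← mul_assoc, ← ENNReal.ofReal_mul (gaussianPDFReal_nonneg _ _ _)]
  congr 2
  simp only [gaussianPDFReal, Real.coe_toNNReal _ (sq_nonneg σ)]
  rw [mul_assoc _ (Real.exp _), ← Real.exp_add]
  congr 2
  ring

/-- The likelihood ratio of a history under mean rewards `μ` with respect to mean rewards `μ₀`. -/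
noncomputable def likelihoodRatio {K t : ℕ} (σ : ℝ) (μ μ₀ : Fin K → ℝ) (h : History K t) : ℝ :=
  Real.exp (∑ s, (((h s).2 - μ₀ (h s).1) ^ 2 - ((h s).2 - μ (h s).1) ^ 2) / (2 * σ ^ 2))

lemma likelihoodRatio_pos {K t : ℕ} (σ : ℝ) (μ μ₀ : Fin K → ℝ) (h : History K t) :
    0 < likelihoodRatio σ μ μ₀ h := Real.exp_pos _

lemma measurable_apply_fin {K : ℕ} {α : Type*} [MeasurableSpace α] {f : α → Fin K → ℝ}
    {g : α → Fin K} (hf : Measurable f) (hg : Measurable g) : Measurable fun x => f x (g x) :=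
  (measurable_from_prod_countable_left (f := fun p : (Fin K → ℝ) × Fin K => p.1 p.2)
    fun i => measurable_pi_apply i).comp (hf.prodMk hg)

lemma measurable_likelihoodRatio_uncurry {K t : ℕ} (σ : ℝ) (μ₀ : Fin K → ℝ) :
    Measurable fun x : (Fin K → ℝ) × History K t => likelihoodRatio σ x.1 μ₀ x.2 := by
  unfold likelihoodRatio
  refine Real.measurable_exp.comp (Finset.measurable_sum _ fun s _ => ?_)
  have h1 : Measurable fun x : (Fin K → ℝ) × History K t => (x.2 s).1 := by fun_prop
  have h2 : Measurable fun x : (Fin K → ℝ) × History K t => x.1 (x.2 s).1 :=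
    measurable_apply_fin measurable_fst h1
  have h3 : Measurable fun x : (Fin K → ℝ) × History K t => μ₀ (x.2 s).1 :=
    measurable_apply_fin measurable_const h1
  fun_prop

lemma measurable_likelihoodRatio {K t : ℕ} (σ : ℝ) (μ μ₀ : Fin K → ℝ) :
    Measurable fun h : History K t => likelihoodRatio σ μ μ₀ h := by
  refine Real.measurable_exp.comp (Finset.measurable_sum _ fun s _ => ?_)
  have h1 : Measurable fun h : History K t => (h s).1 := by fun_prop
  have h2 : Measurable fun h : History K t => μ (h s).1 :=
    measurable_apply_fin measurable_const h1
  have h3 : Measurable fun h : History K t => μ₀ (h s).1 :=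
    measurable_apply_fin measurable_const h1
  fun_prop

lemma likelihoodRatio_snoc {K t : ℕ} (σ : ℝ) (μ μ₀ : Fin K → ℝ) (h : History K t)
    (i : Fin K) (x : ℝ) :
    likelihoodRatio σ μ μ₀ (Fin.snoc (α := fun _ => Fin K × ℝ) h (i, x) : History K (t + 1)) =
      likelihoodRatio σ μ μ₀ h *
        Real.exp (((x - μ₀ i) ^ 2 - (x - μ i) ^ 2) / (2 * σ ^ 2)) := by
  simp [likelihoodRatio, Fin.sum_univ_castSucc, Real.exp_add]

lemma measurable_snoc (K t : ℕ) :
    Measurable fun x : History K t × (Fin K × ℝ) =>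
      (Fin.snoc (α := fun _ => Fin K × ℝ) x.1 x.2 : History K (t + 1)) := by
  refine measurable_pi_lambda _ fun s => ?_
  refine Fin.lastCases ?_ (fun s => ?_) s
  · simpa using measurable_snd
  · simpa using show Measurable fun x : History K t × (Fin K × ℝ) => x.1 s by fun_prop

instance isMarkovKernel_rewardKernel {K : ℕ} (σ : ℝ) (μ : Fin K → ℝ) :
    IsMarkovKernel (rewardKernel σ μ) :=
  ⟨fun i => inferInstanceAs (IsProbabilityMeasure (gaussianReal (μ i) (σ ^ 2).toNNReal))⟩

instance isProbabilityMeasure_historyLaw {K n : ℕ} (p : Policy K n) (σ : ℝ) (μ : Fin K → ℝ)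
    (t : ℕ) (ht : t ≤ n) : IsProbabilityMeasure (p.historyLaw σ μ t ht) := by
  induction t with
  | zero => unfold Policy.historyLaw; infer_instance
  | succ t ih =>
    have := ih (Nat.le_of_succ_le ht)
    have : IsMarkovKernel (α := History K t) (p.arm ⟨t, ht⟩) := p.isMarkov_arm ⟨t, ht⟩
    unfold Policy.historyLaw
    exact Measure.isProbabilityMeasure_map (measurable_snoc K t).aemeasurable

instance isProbabilityMeasure_recommendationLaw {K n : ℕ} (p : Policy K n) (σ : ℝ)
    (μ : Fin K → ℝ) : IsProbabilityMeasure (p.recommendationLaw σ μ) := by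
  unfold Policy.recommendationLaw; infer_instance

lemma Policy.lintegral_historyLaw_succ {K n : ℕ} (p : Policy K n) (σ : ℝ) (μ : Fin K → ℝ)
    {t : ℕ} (ht : t + 1 ≤ n) {f : History K (t + 1) → ENNReal} (hf : Measurable f) :
    ∫⁻ h, f h ∂(p.historyLaw σ μ (t + 1) ht) =
      ∫⁻ h, ∫⁻ i, ∫⁻ x, f (Fin.snoc (α := fun _ => Fin K × ℝ) h (i, x))
        ∂(gaussianReal (μ i) (σ ^ 2).toNNReal) ∂(p.arm ⟨t, ht⟩ h)
        ∂(p.historyLaw σ μ t (Nat.le_of_succ_le ht)) := by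
  have hg : Measurable fun x : History K t × (Fin K × ℝ) =>
      f (Fin.snoc (α := fun _ => Fin K × ℝ) x.1 x.2) := hf.comp (measurable_snoc K t)
  have : IsMarkovKernel (α := History K t) (p.arm ⟨t, ht⟩) := p.isMarkov_arm ⟨t, ht⟩
  rw [Policy.historyLaw, lintegral_map hf (measurable_snoc K t), Measure.lintegral_compProd hg]
  refine lintegral_congr fun h => ?_
  exact Kernel.lintegral_compProd _ _ _ (hg.comp measurable_prodMk_left)

/-- The history laws for two vectors of mean rewards are related by the likelihood ratio. -/
lemma Policy.lintegral_historyLaw_change_mean {K n : ℕ} (p : Policy K n) {σ : ℝ} (hσ : 0 < σ)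
    (μ μ₀ : Fin K → ℝ) (t : ℕ) (ht : t ≤ n) {f : History K t → ENNReal} (hf : Measurable f) :
    ∫⁻ h, f h ∂(p.historyLaw σ μ t ht) =
      ∫⁻ h, f h * ENNReal.ofReal (likelihoodRatio σ μ μ₀ h) ∂(p.historyLaw σ μ₀ t ht) := by
  induction t with
  | zero =>
    unfold Policy.historyLaw
    simp [likelihoodRatio]
  | succ t ih =>
    have : IsMarkovKernel (α := History K t) (p.arm ⟨t, ht⟩) := p.isMarkov_arm ⟨t, ht⟩
    have hs : ∀ h : History K t, ∀ i : Fin K, Measurable fun x : ℝ =>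
        f (Fin.snoc (α := fun _ => Fin K × ℝ) h (i, x)) := fun h i =>
      (hf.comp (measurable_snoc K t)).comp
        (measurable_prodMk_left.comp measurable_prodMk_left)
    have hF : Measurable fun h : History K t =>
        ∫⁻ i, ∫⁻ x, f (Fin.snoc (α := fun _ => Fin K × ℝ) h (i, x))
          ∂(gaussianReal (μ i) (σ ^ 2).toNNReal) ∂(p.arm ⟨t, ht⟩ h) := by
      have := ((hf.comp (measurable_snoc K t)).lintegral_kernel_prod_right'
        (κ := (p.arm ⟨t, ht⟩) ⊗ₖ (Kernel.prodMkLeft (History K t) (rewardKernel σ μ))))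
      convert this using 2 with h
      exact (Kernel.lintegral_compProd (α := History K t) (p.arm ⟨t, ht⟩)
        (Kernel.prodMkLeft (History K t) (rewardKernel σ μ)) h
        ((hf.comp (measurable_snoc K t)).comp measurable_prodMk_left)).symm
    have hL := (measurable_likelihoodRatio (t := t + 1) σ μ μ₀).ennreal_ofReal
    rw [p.lintegral_historyLaw_succ σ μ ht hf, ih (Nat.le_of_succ_le ht) hF,
      p.lintegral_historyLaw_succ σ μ₀ ht
        (f := fun h => f h * ENNReal.ofReal (likelihoodRatio σ μ μ₀ h)) (hf.mul hL)]
    refine lintegral_congr fun h => ?_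
    -- The arm kernel is the same under both instances, so only the reward law contributes a factor.
    rw [mul_comm, ← lintegral_const_mul _ (measurable_of_countable _)]
    refine lintegral_congr fun i => ?_
    rw [lintegral_gaussianReal_change_mean (μ i) (μ₀ i) hσ (hs h i),
      ← lintegral_const_mul _ (f := fun x => f (Fin.snoc (α := fun _ => Fin K × ℝ) h (i, x)) *
        ENNReal.ofReal (Real.exp (((x - μ₀ i) ^ 2 - (x - μ i) ^ 2) / (2 * σ ^ 2))))
        ((hs h i).mul (by fun_prop))]
    refine lintegral_congr fun x => ?_
    rw [likelihoodRatio_snoc, ENNReal.ofReal_mul (likelihoodRatio_pos _ _ _ _).le]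
    ring

lemma Policy.lintegral_likelihoodRatio {K n : ℕ} (p : Policy K n) {σ : ℝ} (hσ : 0 < σ)
    (μ μ₀ : Fin K → ℝ) :
    ∫⁻ h, ENNReal.ofReal (likelihoodRatio σ μ μ₀ h) ∂(p.historyLaw σ μ₀ n le_rfl) = 1 := by
  simpa using (p.lintegral_historyLaw_change_mean hσ μ μ₀ n le_rfl
    (f := fun _ => 1) measurable_const).symm

lemma Policy.recommendationLaw_apply {K n : ℕ} (p : Policy K n) {σ : ℝ} (hσ : 0 < σ)
    (μ μ₀ : Fin K → ℝ) (s : Set (Fin K)) :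
    p.recommendationLaw σ μ s =
      ∫⁻ h, p.recommend h s * ENNReal.ofReal (likelihoodRatio σ μ μ₀ h)
        ∂(p.historyLaw σ μ₀ n le_rfl) := by
  rw [Policy.recommendationLaw,
    Measure.bind_apply (Set.toFinite s).measurableSet (Kernel.aemeasurable _),
    p.lintegral_historyLaw_change_mean hσ μ μ₀ n le_rfl
      (Kernel.measurable_coe _ (Set.toFinite s).measurableSet)]

/-! ### Measurability in the mean rewards -/

/-- Under the fixed reference mean `0`, `μ` enters only through the jointly measurable likelihood
ratio. -/
lemma Policy.measurable_recommendationLaw_apply {K n : ℕ} (p : Policy K n) {σ : ℝ} (hσ : 0 < σ)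
    (s : Set (Fin K)) : Measurable fun μ => p.recommendationLaw σ μ s := by
  simp_rw [fun μ => p.recommendationLaw_apply hσ μ 0 s]
  refine Measurable.lintegral_prod_right' (f := fun x : (Fin K → ℝ) × History K n =>
    p.recommend x.2 s * ENNReal.ofReal (likelihoodRatio σ x.1 0 x.2)) ?_
  exact ((Kernel.measurable_coe _ (Set.toFinite s).measurableSet).comp measurable_snd).mul
    (measurable_likelihoodRatio_uncurry σ 0).ennreal_ofReal

lemma Policy.measurable_misidentificationProb {K n : ℕ} (p : Policy K n) {σ : ℝ} (hσ : 0 < σ) :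
    Measurable (p.misidentificationProb σ) := by
  classical
  -- The set of wrong arms itself varies with `μ`; summing over arms separates it from the law.
  have key : p.misidentificationProb σ = fun μ => ∑ j,
      if ¬ ∀ i, μ i ≤ μ j then (p.recommendationLaw σ μ {j}).toReal else 0 := by
    funext μ
    have : {j | ¬ ∀ i, μ i ≤ μ j} =
        ((Finset.univ.filter fun j => ¬ ∀ i, μ i ≤ μ j : Finset (Fin K)) : Set (Fin K)) := by
      ext; simp
    rw [Policy.misidentificationProb, this, ← sum_measureReal_singleton, Finset.sum_filter]
    rfl
  rw [key]
  refine Finset.measurable_sum _ fun j _ => Measurable.ite ?_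
    (p.measurable_recommendationLaw_apply hσ {j}).ennreal_toReal measurable_const
  simp only [Set.ofPred_forall, ← Set.compl_ofPred]
  exact (MeasurableSet.iInter fun i =>
    measurableSet_le (measurable_pi_apply i) (measurable_pi_apply j)).compl

lemma Policy.misidentificationProb_nonneg {K n : ℕ} (p : Policy K n) (σ : ℝ) (μ : Fin K → ℝ) :
    0 ≤ p.misidentificationProb σ μ := measureReal_nonneg

lemma Policy.misidentificationProb_le_one {K n : ℕ} (p : Policy K n) (σ : ℝ) (μ : Fin K → ℝ) :
    p.misidentificationProb σ μ ≤ 1 := measureReal_le_one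

instance isProbabilityMeasure_gaussianPrior {K : ℕ} (ν : Fin K → ℝ) (σ₀ : ℝ) :
    IsProbabilityMeasure (gaussianPrior ν σ₀) := by
  unfold gaussianPrior; infer_instance

lemma Policy.integrable_misidentificationProb {K n : ℕ} (p : Policy K n) {σ : ℝ} (hσ : 0 < σ)
    (m : Measure (Fin K → ℝ)) [IsFiniteMeasure m] :
    Integrable (p.misidentificationProb σ) m :=
  Integrable.of_bound (p.measurable_misidentificationProb hσ).aestronglyMeasurable 1
    (ae_of_all _ fun μ => by
      rw [Real.norm_eq_abs, abs_of_nonneg (p.misidentificationProb_nonneg σ μ)]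
      exact p.misidentificationProb_le_one σ μ)

/-! ### Two-point lower bound -/

/-- The difference of the sides is the sum of the two nonnegative terms `h1` and `h2`. Here `a`, `b`
will be the recommendation probabilities and `x`, `y` the likelihood ratios. -/
lemma mul_le_convex_combination_add {a b x y : ℝ} (ha : 0 ≤ a) (hb : 0 ≤ b) (hab : a + b = 1)
    (hx : 0 ≤ x) (hy : 0 ≤ y) : x * y ≤ a * x + b * y + x * y / 4 * (x + y) := by
  have h1 : 0 ≤ a * (x * ((1 - y / 2) ^ 2 + x * y / 4)) := by positivity
  have h2 : 0 ≤ b * (y * ((1 - x / 2) ^ 2 + x * y / 4)) := by positivity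
  obtain rfl : b = 1 - a := by linarith
  nlinarith

/-- In a two-armed bandit, the likelihood ratios of two instances that differ by a swap of the
arms, with respect to the instance with both means in the middle, have a constant product. -/
lemma likelihoodRatio_mul_swap {n : ℕ} (σ : ℝ) (μ : Fin 2 → ℝ) (h : History 2 n) :
    likelihoodRatio σ μ (fun _ => (μ 0 + μ 1) / 2) h *
        likelihoodRatio σ (μ ∘ Equiv.swap 0 1) (fun _ => (μ 0 + μ 1) / 2) h =
      Real.exp (-(n * (μ 0 - μ 1) ^ 2 / (4 * σ ^ 2))) := by
  rw [likelihoodRatio, likelihoodRatio, ← Real.exp_add, ← Finset.sum_add_distrib]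
  congr 1
  -- The two means of an arm lie symmetrically about the midpoint, so the terms linear in the reward
  -- cancel.
  have : ∀ s : Fin n, ((h s).2 - (μ 0 + μ 1) / 2) ^ 2 - ((h s).2 - μ (h s).1) ^ 2 +
      (((h s).2 - (μ 0 + μ 1) / 2) ^ 2 - ((h s).2 - (μ ∘ Equiv.swap 0 1) (h s).1) ^ 2) =
      -((μ 0 - μ 1) ^ 2 / 2) := by
    intro s
    rcases h s with ⟨i, x⟩
    fin_cases i <;> simp <;> ring
  simp_rw [← add_div, this]
  simp
  ring

/-- Le Cam's two-point bound for an instance and the instance with the arms swapped. -/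
lemma Policy.le_recommendationLaw_add_swap {n : ℕ} (p : Policy 2 n) {σ : ℝ} (hσ : 0 < σ)
    (μ : Fin 2 → ℝ) :
    1 / 2 * Real.exp (-(n * (μ 0 - μ 1) ^ 2 / (4 * σ ^ 2))) ≤
      (p.recommendationLaw σ μ).real {0} +
        (p.recommendationLaw σ (μ ∘ Equiv.swap 0 1)).real {1} := by
  set c := Real.exp (-(n * (μ 0 - μ 1) ^ 2 / (4 * σ ^ 2))) with hc
  have hc0 : 0 < c := Real.exp_pos _
  set μ₀ : Fin 2 → ℝ := fun _ => (μ 0 + μ 1) / 2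
  set x := fun h : History 2 n => likelihoodRatio σ μ μ₀ h
  set y := fun h : History 2 n => likelihoodRatio σ (μ ∘ Equiv.swap 0 1) μ₀ h
  have hx : Measurable x := measurable_likelihoodRatio _ _ _
  have hy : Measurable y := measurable_likelihoodRatio _ _ _
  have hr : ∀ j : Fin 2, Measurable fun h => p.recommend h {j} := fun j =>
    Kernel.measurable_coe _ (measurableSet_singleton j)
  have hxy : Measurable fun h => ENNReal.ofReal (x h) + ENNReal.ofReal (y h) := by fun_prop
  -- The `1 + 1` is the total mass of the two likelihood ratios; the last term is thus `c/2`, half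
  -- of the left side.
  have key : ENNReal.ofReal c ≤ p.recommendationLaw σ μ {0} +
      p.recommendationLaw σ (μ ∘ Equiv.swap 0 1) {1} + ENNReal.ofReal (c / 4) * (1 + 1) := by
    have hxy1 : ∫⁻ h, (ENNReal.ofReal (x h) + ENNReal.ofReal (y h))
        ∂(p.historyLaw σ μ₀ n le_rfl) = 1 + 1 := by
      rw [lintegral_add_left hx.ennreal_ofReal, p.lintegral_likelihoodRatio hσ,
        p.lintegral_likelihoodRatio hσ]
    rw [p.recommendationLaw_apply hσ μ μ₀, p.recommendationLaw_apply hσ _ μ₀, ← hxy1,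
      ← lintegral_const_mul _ hxy]
    erw [← lintegral_add_left ((hr 0).mul hx.ennreal_ofReal)]
    rw [← lintegral_add_right _ (hxy.const_mul _)]
    calc ENNReal.ofReal c = ∫⁻ _, ENNReal.ofReal c ∂(p.historyLaw σ μ₀ n le_rfl) := by simp
      _ ≤ _ := lintegral_mono fun h => ?_
    have hx0 : 0 ≤ x h := (likelihoodRatio_pos _ _ _ _).le
    have hy0 : 0 ≤ y h := (likelihoodRatio_pos _ _ _ _).le
    have hxy : x h * y h = c := likelihoodRatio_mul_swap σ μ h
    have hsum : (p.recommend h).real {0} + (p.recommend h).real {1} = 1 := by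
      have := sum_measureReal_singleton (μ := p.recommend h) (Finset.univ : Finset (Fin 2))
      rwa [Fin.sum_univ_two, Finset.coe_univ, probReal_univ] at this
    have hineq := mul_le_convex_combination_add (measureReal_nonneg (μ := p.recommend h))
      (measureReal_nonneg (μ := p.recommend h)) hsum hx0 hy0
    rw [hxy] at hineq
    refine (ENNReal.ofReal_le_ofReal hineq).trans_eq ?_
    rw [ENNReal.ofReal_add (by positivity) (by positivity),
      ENNReal.ofReal_add (by positivity) (by positivity), ENNReal.ofReal_mul (by positivity),
      ENNReal.ofReal_mul (by positivity), ENNReal.ofReal_mul (by positivity),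
      ENNReal.ofReal_add hx0 hy0, ofReal_measureReal, ofReal_measureReal]
    rfl
  have := ENNReal.toReal_mono (by finiteness) key
  rw [ENNReal.toReal_add (by finiteness) (by finiteness),
    ENNReal.toReal_add (by finiteness) (by finiteness), ENNReal.toReal_mul,
    ENNReal.toReal_ofReal hc0.le, ENNReal.toReal_ofReal (by positivity)] at this
  norm_num at this
  simp only [measureReal_def]
  linarith

lemma Policy.misidentificationProb_of_lt {n : ℕ} (p : Policy 2 n) (σ : ℝ) {μ : Fin 2 → ℝ}
    (h : μ 0 < μ 1) : p.misidentificationProb σ μ = (p.recommendationLaw σ μ).real {0} := by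
  rw [Policy.misidentificationProb]
  congr 1
  ext j
  fin_cases j <;> simp [Fin.forall_fin_two, h, h.le]

lemma Policy.misidentificationProb_of_gt {n : ℕ} (p : Policy 2 n) (σ : ℝ) {μ : Fin 2 → ℝ}
    (h : μ 1 < μ 0) : p.misidentificationProb σ μ = (p.recommendationLaw σ μ).real {1} := by
  rw [Policy.misidentificationProb]
  congr 1
  ext j
  fin_cases j <;> simp [Fin.forall_fin_two, h, h.le]

lemma Policy.le_misidentificationProb_add_swap {n : ℕ} (p : Policy 2 n) {σ : ℝ} (hσ : 0 < σ)
    {μ : Fin 2 → ℝ} (hμ : μ 0 ≠ μ 1) :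
    1 / 2 * Real.exp (-(n * (μ 0 - μ 1) ^ 2 / (4 * σ ^ 2))) ≤
      p.misidentificationProb σ μ + p.misidentificationProb σ (μ ∘ Equiv.swap 0 1) := by
  rcases hμ.lt_or_gt with h | h
  · rw [p.misidentificationProb_of_lt σ h, p.misidentificationProb_of_gt σ (by simpa using h)]
    exact p.le_recommendationLaw_add_swap hσ μ
  · rw [p.misidentificationProb_of_gt σ h, p.misidentificationProb_of_lt σ (by simpa using h),
      add_comm]
    have hs : (μ ∘ Equiv.swap 0 1) ∘ Equiv.swap 0 1 = μ := by
      funext i; simp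
    have := p.le_recommendationLaw_add_swap hσ (μ ∘ Equiv.swap 0 1)
    rw [hs] at this
    have hsq : ((μ ∘ Equiv.swap 0 1) 0 - (μ ∘ Equiv.swap 0 1) 1) ^ 2 = (μ 0 - μ 1) ^ 2 := by
      simp only [Function.comp_apply, Equiv.swap_apply_left, Equiv.swap_apply_right]
      ring
    rwa [hsq] at this

/-! ### Averaging over the symmetric prior -/

/-- The prior is invariant under a swap of the arms when the prior means agree. -/
lemma measurePreserving_swap_gaussianPrior (c σ₀ : ℝ) :
    MeasurePreserving (fun μ : Fin 2 → ℝ => μ ∘ Equiv.swap 0 1)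
      (gaussianPrior (fun _ => c) σ₀) (gaussianPrior (fun _ => c) σ₀) :=
  measurePreserving_arrowCongr' (fun _ => gaussianReal c (σ₀ ^ 2).toNNReal)
    (fun _ => gaussianReal c (σ₀ ^ 2).toNNReal) (Equiv.swap (0 : Fin 2) 1)
    (MeasurableEquiv.refl ℝ) fun _ => MeasurePreserving.id _

lemma gaussianPrior_map_sub (c σ₀ : ℝ) :
    (gaussianPrior (fun _ : Fin 2 => c) σ₀).map (fun μ => μ 0 - μ 1) =
      gaussianReal 0 (2 * σ₀ ^ 2).toNNReal := by
  have hind : iIndepFun (fun (i : Fin 2) (μ : Fin 2 → ℝ) => μ i)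
      (gaussianPrior (fun _ : Fin 2 => c) σ₀) :=
    iIndepFun_pi (X := fun _ => id) fun _ => aemeasurable_id
  have h01 : IndepFun (fun μ : Fin 2 → ℝ => μ 0) (fun μ => -μ 1)
      (gaussianPrior (fun _ : Fin 2 => c) σ₀) :=
    (hind.indepFun (by decide : (0 : Fin 2) ≠ 1)).comp measurable_id measurable_neg
  have hmap : ∀ i : Fin 2, (gaussianPrior (fun _ : Fin 2 => c) σ₀).map (fun μ => μ i) =
      gaussianReal c (σ₀ ^ 2).toNNReal := fun i =>
    (measurePreserving_eval (fun _ : Fin 2 => gaussianReal c (σ₀ ^ 2).toNNReal) i).map_eq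
  have hneg : (gaussianPrior (fun _ : Fin 2 => c) σ₀).map (fun μ => -μ 1) =
      gaussianReal (-c) (σ₀ ^ 2).toNNReal := by
    rw [← gaussianReal_map_neg, ← hmap 1, Measure.map_map measurable_neg (by fun_prop)]
    rfl
  have := gaussianReal_add_gaussianReal_of_indepFun h01 (hmap 0) hneg
  rw [two_mul, Real.toNNReal_add (sq_nonneg _) (sq_nonneg _)]
  simpa [Pi.add_def, sub_eq_add_neg] using this

/-- Ties must be discarded: there both misidentification probabilities vanish and the two-point
bound fails. -/
lemma ae_ne_gaussianPrior (c : ℝ) {σ₀ : ℝ} (hσ₀ : 0 < σ₀) :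
    ∀ᵐ μ ∂(gaussianPrior (fun _ : Fin 2 => c) σ₀), μ 0 ≠ μ 1 := by
  have hv : (2 * σ₀ ^ 2).toNNReal ≠ 0 := by simpa using pow_pos hσ₀ 2
  have := nullSingletonClass_gaussianReal (μ := 0) hv
  have h : ∀ᵐ x ∂((gaussianPrior (fun _ : Fin 2 => c) σ₀).map fun μ => μ 0 - μ 1), x ≠ 0 := by
    rw [gaussianPrior_map_sub]
    exact Measure.ae_ne _ 0
  filter_upwards [ae_of_ae_map (by fun_prop) h] with μ hμ
  exact sub_ne_zero.mp hμ

lemma integral_exp_neg_mul_sq_gaussianReal {v : NNReal} (hv : v ≠ 0) {b : ℝ} (hb : 0 ≤ b) :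
    ∫ x, Real.exp (-(b * x ^ 2)) ∂(gaussianReal 0 v) = Real.sqrt (1 / (1 + 2 * v * b)) := by
  have hv0 : (0 : ℝ) < v := by positivity
  rw [integral_gaussianReal_eq_integral_smul hv]
  have : ∀ x : ℝ, gaussianPDFReal 0 v x • Real.exp (-(b * x ^ 2)) =
      (Real.sqrt (2 * Real.pi * v))⁻¹ * Real.exp (-(1 / (2 * v) + b) * x ^ 2) := by
    intro x
    rw [gaussianPDFReal, smul_eq_mul, mul_assoc, ← Real.exp_add]
    congr 2
    ring
  simp_rw [this]
  rw [integral_const_mul, integral_gaussian, ← Real.sqrt_inv, ← Real.sqrt_mul (by positivity)]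
  congr 1
  field_simp

/-- A lower bound for the expected misidentification probability under a prior with equal
means. -/
lemma Policy.le_expectedMisidentificationProb {n : ℕ} (p : Policy 2 n) {σ σ₀ : ℝ} (hσ : 0 < σ)
    (hσ₀ : 0 < σ₀) (c : ℝ) :
    1 / 4 * Real.sqrt (σ ^ 2 / (n * σ₀ ^ 2 + σ ^ 2)) ≤
      p.expectedMisidentificationProb σ (fun _ => c) σ₀ := by
  have hv : (2 * σ₀ ^ 2).toNNReal ≠ 0 := by simpa using pow_pos hσ₀ 2
  have hswap := measurePreserving_swap_gaussianPrior c σ₀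
  have hint := p.integrable_misidentificationProb hσ (gaussianPrior (fun _ : Fin 2 => c) σ₀)
  have hint' := hswap.integrable_comp_of_integrable hint
  have hsymm : ∫ μ, p.misidentificationProb σ (μ ∘ Equiv.swap 0 1)
      ∂(gaussianPrior (fun _ : Fin 2 => c) σ₀) =
      p.expectedMisidentificationProb σ (fun _ => c) σ₀ := by
    conv_rhs => rw [Policy.expectedMisidentificationProb, ← hswap.map_eq]
    rw [integral_map hswap.aemeasurable
      (p.measurable_misidentificationProb hσ).aestronglyMeasurable]
  have hgauss : ∫ μ, Real.exp (-(n * (μ 0 - μ 1) ^ 2 / (4 * σ ^ 2)))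
      ∂(gaussianPrior (fun _ : Fin 2 => c) σ₀) = Real.sqrt (σ ^ 2 / (n * σ₀ ^ 2 + σ ^ 2)) := by
    have h1 := integral_map (μ := gaussianPrior (fun _ : Fin 2 => c) σ₀)
      (φ := fun μ => μ 0 - μ 1) (f := fun x => Real.exp (-(n / (4 * σ ^ 2) * x ^ 2)))
      (by fun_prop) (by fun_prop)
    rw [gaussianPrior_map_sub, integral_exp_neg_mul_sq_gaussianReal hv (by positivity)] at h1
    convert h1.symm using 2
    · funext μ; congr 1; ring
    · rw [Real.coe_toNNReal _ (by positivity)]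
      field_simp
      ring
  have hexp : Integrable (fun μ : Fin 2 → ℝ =>
      1 / 2 * Real.exp (-(n * (μ 0 - μ 1) ^ 2 / (4 * σ ^ 2))))
      (gaussianPrior (fun _ : Fin 2 => c) σ₀) := by
    refine Integrable.const_mul (Integrable.of_bound (by fun_prop) 1 (ae_of_all _ fun μ => ?_)) _
    rw [Real.norm_eq_abs, Real.abs_exp, Real.exp_le_one_iff, neg_nonpos]
    positivity
  have hmono := integral_mono_ae hexp (hint.add hint')
    ((ae_ne_gaussianPrior c hσ₀).mono fun μ hμ => p.le_misidentificationProb_add_swap hσ hμ)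
  have hadd := integral_add hint hint'
  simp only [Pi.add_apply, Function.comp_apply] at hmono hadd
  rw [hadd, integral_const_mul, hgauss] at hmono
  have h2 : p.expectedMisidentificationProb σ (fun _ => c) σ₀ =
    ∫ μ, p.misidentificationProb σ μ ∂(gaussianPrior (fun _ : Fin 2 => c) σ₀) := rfl
  rw [hsymm, ← h2] at hmono
  linarith

theorem theorem3 (n : ℕ) (hn : 1 ≤ n) (σ σ₀ : ℝ) (hσ : 0 < σ) (hσ₀ : 0 < σ₀)
    (p : (Fin 2 → ℝ) → Policy 2 n) :
    ∃ ν : Fin 2 → ℝ,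
      1 / (2 * Real.exp 1) *
          Real.sqrt (σ ^ 2 / (2 * n * (8 * Real.log (2 * n) + 1) * σ₀ ^ 2 + σ ^ 2)) *
          Real.exp (-((ν 0 - ν 1) ^ 2 / (4 * σ₀ ^ 2)))
        ≤ (p ν).expectedMisidentificationProb σ ν σ₀ := by
  -- Any equal means would do. The rest is slack: `2e ≥ 4`, and the logarithmic factor only enlarges
  -- the denominator.
  refine ⟨fun _ => 0, le_trans ?_ ((p fun _ => 0).le_expectedMisidentificationProb hσ hσ₀ 0)⟩
  have hn' : (1 : ℝ) ≤ n := by exact_mod_cast hn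
  have hlog : 0 ≤ Real.log (2 * n) := Real.log_nonneg (by linarith)
  have he : (2 : ℝ) ≤ Real.exp 1 := by linarith [Real.add_one_le_exp (1 : ℝ)]
  simp only [sub_self, ne_eq, OfNat.ofNat_ne_zero, not_false_eq_true, zero_pow, zero_div,
    neg_zero, Real.exp_zero, mul_one]
  refine mul_le_mul (one_div_le_one_div_of_le (by norm_num) (by linarith)) ?_
    (Real.sqrt_nonneg _) (by norm_num)
  refine Real.sqrt_le_sqrt (div_le_div_of_nonneg_left (by positivity) (by positivity) ?_)
  have : (n : ℝ) ≤ 2 * n * (8 * Real.log (2 * n) + 1) := by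
    nlinarith [mul_nonneg (by linarith : (0 : ℝ) ≤ n) hlog]
  gcongr
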